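/- **Theorem (Scale invariant t-test martingale).** Let $X_1,X_2,\dots$ be real random variables on a measurable space, and write $S_n=\sum_{i=1}^n X_i$, $V_n=\sum_{i=1}^n X_i^2$, $\overline{X}_n=S_n/n$, $\overline{X^2_n}=V_n/n$. Let $\mathcal N$ be the class of all normal distributions $N_{\mu,\sigma^2}$ on $\mathbb R$ with $\mu\in\mathbb R$, $\sigma^2>0$, let $\mathcal N_{\mu=0}$ be the subclass of those with mean $0$, and let $p_{\mu,\sigma^2}$ be the density of $N_{\mu,\sigma^2}$. For $n\ge1$ let $\mathcal F_n^*$ be the $\sigma$-algebra generated by all $f(X_1,\dots,X_n)$ with $f:\mathbb R^n\to\mathbb R$ measurable and scale invariant, i.e. $f(\lambda x_1,\dots,\lambda x_n)=f(x_1,\dots,x_n)$ for all $\lambda>0$. Let $c>0$ and $$G_n^{(c)}=\sqrt{\frac{c^2}{n+c^2}}\left(\frac{(n+c^2)V_n}{(n+c^2)V_n-S_n^2}\right)^{n/2},\qquad n\ge 1$$ (with the convention $G_n^{(c)}=0$ on the event $V_n=0$, which is null when the data are i.i.d. normal). 1. $\{G_n^{(c)}\}_{n\ge1}$ is a test martingale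 for $\mathcal N_{\mu=0}$ on $\{\mathcal F_n^*\}_{n\ge1}$: whenever $X_1,X_2,\dots$ are i.i.d. with a distribution in $\mathcal N_{\mu=0}$, it is a nonnegative martingale with respect to $\{\mathcal F^*_n\}$, with $G_1^{(c)}=1$ almost surely and $\mathbb E[G_n^{(c)}]=1$ for all $n\ge1$. 2. It is a Gaussian mixture of scale invariant likelihood ratios: for every $n\ge 1$, wherever $V_n>0$, $$G_n^{(c)}=\int_{\mathbb R}h_n(\theta;0)\,N_{0,c^{-2}}(\mathrm d\theta),\qquad h_n(\theta;\theta_0)=\frac{\int_0^\infty\left\{\prod_{i=1}^n p_{\tau\theta,\tau^2}(X_i)\right\}\frac{\mathrm d\tau}{\tau}}{\int_0^\infty\left\{\prod_{i=1}^n p_{\tau\theta_0,\tau^2}(X_i)\right\}\frac{\mathrm d\tau}{\tau}}.$$ 3. For every $\alpha\in(0,1)$, with $$\operatorname{radius}_n=\sqrt{\frac{(n+c^2)\left(1-\left(\frac{\alpha^2c^2}{n+c^2}\right)^{1/n}\right)}{\left\{\left(\frac{\alpha^2c^2}{n+c^2}\right)^{1/n}(n+c^2)-c^2\right\}\vee0}\left(\overline{X^2_n}-\overline{X}_n^2\right)}$$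 (and $\operatorname{radius}_n=\infty$, so that the interval is all of $\mathbb R$, when the denominator is $0$), the intervals $[\overline X_n\pm\operatorname{radius}_n]$ form a $(1-\alpha)$-confidence sequence for the mean over $\mathcal N$: whenever $X_1,X_2,\dots$ are i.i.d. with distribution $N_{\mu,\sigma^2}\in\mathcal N$, $$\Pr\left[\,\forall n\ge1,\ \mu\in[\overline X_n\pm\operatorname{radius}_n]\,\right]\ge1-\alpha .$$ -/

import Mathlib

open MeasureTheory ProbabilityTheory
open scoped ENNReal NNReal

noncomputable section

namespace TTest

/-- The class of all nondegenerate normal distributions on `ℝ`. -/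
def normalClass : Set (Measure ℝ) :=
  {P | ∃ (m : ℝ) (v : ℝ≥0), v ≠ 0 ∧ P = gaussianReal m v}

/-- The class of all nondegenerate normal distributions on `ℝ` with mean `m`. -/
def normalClassMean (m : ℝ) : Set (Measure ℝ) :=
  {P | ∃ v : ℝ≥0, v ≠ 0 ∧ P = gaussianReal m v}

/-- The mean of a distribution on `ℝ`. -/
def mean (P : Measure ℝ) : ℝ := ∫ y, y ∂P

/-- The partial sum `S_n`. A sequence `x₁, x₂, …` is indexed from `0`, so `xᵢ₊₁` is `x i`. -/
def partialSum (n : ℕ) (x : ℕ → ℝ) : ℝ := ∑ i ∈ Finset.range n, x i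

/-- The partial sum of squares `V_n`. -/
def partialSumSq (n : ℕ) (x : ℕ → ℝ) : ℝ := ∑ i ∈ Finset.range n, x i ^ 2

/-- The sample average `S_n / n`. -/
def sampleMean (n : ℕ) (x : ℕ → ℝ) : ℝ := partialSum n x / n

/-- The average square `V_n / n`. -/
def sampleMeanSq (n : ℕ) (x : ℕ → ℝ) : ℝ := partialSumSq n x / n

/-- The process `G_n^{(c)}` as a function of the data. -/
def gValue (c : ℝ) (n : ℕ) (x : ℕ → ℝ) : ℝ :=
  √(c ^ 2 / (n + c ^ 2)) *
    (((n + c ^ 2) * partialSumSq n x) /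
      ((n + c ^ 2) * partialSumSq n x - partialSum n x ^ 2)) ^ ((n : ℝ) / 2)

/-- The mixture `∫_{τ > 0} ∏_{i ≤ n} p_{τθ, τ²}(x_i) dτ / τ` of normal likelihoods. -/
def scaleMixtureLikelihood (n : ℕ) (θ : ℝ) (x : ℕ → ℝ) : ℝ≥0∞ :=
  ∫⁻ τ in Set.Ioi (0 : ℝ),
    (∏ i ∈ Finset.range n, gaussianPDF (τ * θ) (τ ^ 2).toNNReal (x i)) * ENNReal.ofReal τ⁻¹

/-- The scale invariant likelihood ratio `h_n(θ; θ₀)` of the normal family. -/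
def scaleInvLR (n : ℕ) (θ θ₀ : ℝ) (x : ℕ → ℝ) : ℝ≥0∞ :=
  scaleMixtureLikelihood n θ x / scaleMixtureLikelihood n θ₀ x

/-- The denominator `(α² c² / (n + c²))^{1/n} (n + c²) - c²` of the squared radius, before its
positive part is taken. -/
def radiusDenom (c α : ℝ) (n : ℕ) : ℝ :=
  (α ^ 2 * c ^ 2 / (n + c ^ 2)) ^ (1 / (n : ℝ)) * (n + c ^ 2) - c ^ 2

/-- The radius of the interval at time `n`; it is infinite as soon as the positive part of the
denominator is zero, whatever the sample variance is. -/
def radius (c α : ℝ) (n : ℕ) (x : ℕ → ℝ) : EReal :=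
  if max (radiusDenom c α n) 0 = 0 then ⊤
  else ((√((n + c ^ 2) * (1 - (α ^ 2 * c ^ 2 / (n + c ^ 2)) ^ (1 / (n : ℝ))) /
      max (radiusDenom c α n) 0 * (sampleMeanSq n x - sampleMean n x ^ 2)) : ℝ) : EReal)

/-- The interval of the real numbers between `sampleMean - radius` and `sampleMean + radius`. -/
def interval (c α : ℝ) (n : ℕ) (x : ℕ → ℝ) : Set ℝ :=
  {m : ℝ | (sampleMean n x : EReal) - radius c α n x ≤ (m : EReal) ∧
    (m : EReal) ≤ (sampleMean n x : EReal) + radius c α n x}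

/-- Scale invariant (measurable) functions on `ℝⁿ`. -/
def IsScaleInvariant {n : ℕ} (f : (Fin n → ℝ) → ℝ) : Prop :=
  Measurable f ∧ ∀ (x : Fin n → ℝ) (l : ℝ), 0 < l → f (fun i => l * x i) = f x

variable {Ω : Type*}

/-- The `σ`-algebra generated by all `f(X₁, …, X_n)` with `f` scale invariant. -/
@[reducible] def scaleInvSigma (X : ℕ → Ω → ℝ) (n : ℕ) : MeasurableSpace Ω :=
  ⨆ (f : (Fin n → ℝ) → ℝ) (_ : IsScaleInvariant f),
    MeasurableSpace.comap (fun ω => f (fun i : Fin n => X i ω)) inferInstance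

theorem scaleInvSigma_le [mΩ : MeasurableSpace Ω] (X : ℕ → Ω → ℝ) (hX : ∀ i, Measurable (X i))
    (n : ℕ) : scaleInvSigma X n ≤ mΩ := by
  refine iSup₂_le fun f hf => ?_
  have h : Measurable (fun ω => f (fun i : Fin n => X i ω)) :=
    hf.1.comp (measurable_pi_lambda _ fun i => hX i)
  exact h.comap_le

theorem scaleInvSigma_mono (X : ℕ → Ω → ℝ) {m n : ℕ} (h : m ≤ n) :
    scaleInvSigma X m ≤ scaleInvSigma X n := by
  refine iSup₂_le fun f hf => ?_
  have hg : IsScaleInvariant (fun x : Fin n → ℝ => f (fun i => x (Fin.castLE h i))) :=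
    ⟨hf.1.comp (measurable_pi_lambda _ fun i => measurable_pi_apply _),
      fun x l hl => hf.2 (fun i => x (Fin.castLE h i)) l hl⟩
  exact le_iSup₂_of_le (f := fun (f : (Fin n → ℝ) → ℝ) (_ : IsScaleInvariant f) =>
    MeasurableSpace.comap (fun ω => f (fun i : Fin n => X i ω)) inferInstance) _ hg le_rfl

variable [mΩ : MeasurableSpace Ω]

/-- The scale invariant filtration of the data, at the times `n ≥ 1`. -/
def scaleInvFiltration (X : ℕ → Ω → ℝ) (hX : ∀ i, Measurable (X i)) : Filtration ℕ+ mΩ where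
  seq n := scaleInvSigma X n
  mono' _ _ h := scaleInvSigma_mono X h
  le' n := scaleInvSigma_le X hX n

/-- Under `Pr`, the observations `X` are i.i.d. with distribution `P`. -/
def IsIIDSample (X : ℕ → Ω → ℝ) (P : Measure ℝ) (Pr : Measure Ω) : Prop :=
  (∀ i, Measurable (X i)) ∧ iIndepFun X Pr ∧ ∀ i, Pr.map (X i) = P

/-- `M` is a test martingale for the class `𝓠` on the filtration `ℱ`: whenever the data are i.i.d.
from a member of `𝓠`, it is a nonnegative martingale whose initial value has mean one. -/
def IsTestMartingale (X : ℕ → Ω → ℝ) (𝓠 : Set (Measure ℝ)) (ℱ : Filtration ℕ+ mΩ)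
    (M : ℕ+ → Ω → ℝ) : Prop :=
  ∀ P ∈ 𝓠, ∀ Pr : Measure Ω, IsProbabilityMeasure Pr → IsIIDSample X P Pr →
    (∀ n ω, 0 ≤ M n ω) ∧ Martingale M ℱ Pr ∧ ∫ ω, M 1 ω ∂Pr = 1

/-- `CI` is a `(1 - α)`-confidence sequence for the parameter `θ` over the class `𝓠`. -/
def IsConfidenceSequence (X : ℕ → Ω → ℝ) (𝓠 : Set (Measure ℝ)) (θ : Measure ℝ → ℝ) (α : ℝ)
    (CI : ℕ+ → Ω → Set ℝ) : Prop :=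
  ∀ P ∈ 𝓠, ∀ Pr : Measure Ω, IsProbabilityMeasure Pr → IsIIDSample X P Pr →
    ENNReal.ofReal (1 - α) ≤ Pr {ω | ∀ n : ℕ+, θ P ∈ CI n ω}

end TTest

end

/-!
The average `A p (x) = ∫ tⁿ p (t • x) dt / t` of a density `p` on `ℝⁿ` over all scales is symmetric
in the sense that `∫ f q (A p) = ∫ f p (A q)` for `f` homogeneous of degree `n`, since `dt / t` is
invariant under inversion. Taking `f = χ / A p` with `χ` the indicator of a scale invariant set, the
ratio `A q / A p` is the density of `q` with respect to `p` on such sets. The process `G` is a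
Gaussian mixture of such ratios, where `p` is the centred normal likelihood. Hence the mass that
`G n` puts on a scale invariant event of the first `n` observations is the probability of that event
when `θ` is drawn from the mixing distribution and the observations are then i.i.d. `N(θ, 1)`; this
does not depend on `n`, and `G` is a martingale. By Ville's inequality the process evaluated at the
centred observations stays below `1 / α` forever with probability at least `1 - α`, and solving
`G n (x - m) < 1 / α` for `m` gives the interval.
-/

noncomputable section

namespace TTest

section ScaleMeasure

/-- The Haar measure `dτ / τ` of the multiplicative group of positive reals, as a measure on `ℝ`. -/
def scaleMeasure : Measure ℝ :=
  (volume.restrict (Set.Ioi 0)).withDensity fun τ => ENNReal.ofReal τ⁻¹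

instance : SFinite scaleMeasure := by
  unfold scaleMeasure; infer_instance

lemma lintegral_scaleMeasure (F : ℝ → ℝ≥0∞) :
    ∫⁻ τ, F τ ∂scaleMeasure = ∫⁻ τ in Set.Ioi 0, F τ * ENNReal.ofReal τ⁻¹ := by
  rw [scaleMeasure, lintegral_withDensity_eq_lintegral_mul_non_measurable _ (by fun_prop) (by simp)]
  simp only [Pi.mul_apply, mul_comm]

lemma lintegral_scaleMeasure_congr {F G : ℝ → ℝ≥0∞} (h : ∀ τ, 0 < τ → F τ = G τ) :
    ∫⁻ τ, F τ ∂scaleMeasure = ∫⁻ τ, G τ ∂scaleMeasure := by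
  rw [lintegral_scaleMeasure, lintegral_scaleMeasure]
  exact setLIntegral_congr_fun measurableSet_Ioi fun τ hτ => by rw [h τ hτ]

lemma lintegral_scaleMeasure_comp_mul_left (F : ℝ → ℝ≥0∞) {a : ℝ} (ha : 0 < a) :
    ∫⁻ τ, F (a * τ) ∂scaleMeasure = ∫⁻ τ, F τ ∂scaleMeasure := by
  have image : (fun τ : ℝ => a * τ) '' Set.Ioi 0 = Set.Ioi 0 := by
    simpa using Set.image_mul_left_Ioi ha (b := (0 : ℝ))
  have substitution := lintegral_image_eq_lintegral_abs_deriv_mul (measurableSet_Ioi (a := (0 : ℝ)))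
    (fun τ _ => ((hasDerivAt_id τ).const_mul a).hasDerivWithinAt)
    (mul_right_injective₀ ha.ne').injOn fun τ => F τ * ENNReal.ofReal τ⁻¹
  simp only [id_eq] at substitution
  rw [lintegral_scaleMeasure, lintegral_scaleMeasure, ← image, substitution, image]
  refine setLIntegral_congr_fun measurableSet_Ioi fun τ (hτ : 0 < τ) => ?_
  rw [mul_left_comm, ← ENNReal.ofReal_mul (abs_nonneg _), mul_one, abs_of_pos ha]
  congr 2
  field_simp

lemma lintegral_scaleMeasure_comp_inv (F : ℝ → ℝ≥0∞) :
    ∫⁻ τ, F τ⁻¹ ∂scaleMeasure = ∫⁻ τ, F τ ∂scaleMeasure := by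
  have image : (fun τ : ℝ => τ⁻¹) '' Set.Ioi 0 = Set.Ioi 0 := by
    ext; simp
  have substitution := lintegral_image_eq_lintegral_abs_deriv_mul (measurableSet_Ioi (a := (0 : ℝ)))
    (fun τ hτ => (hasDerivAt_inv (ne_of_gt hτ)).hasDerivWithinAt)
    inv_injective.injOn fun τ => F τ * ENNReal.ofReal τ⁻¹
  rw [lintegral_scaleMeasure, lintegral_scaleMeasure, ← image, substitution, image]
  refine setLIntegral_congr_fun measurableSet_Ioi fun τ (hτ : 0 < τ) => ?_
  rw [mul_left_comm, ← ENNReal.ofReal_mul (abs_nonneg _), abs_neg, abs_of_pos (by positivity)]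
  congr 2
  field_simp

end ScaleMeasure

section ScaleAverage

variable {E : Type*} [NormedAddCommGroup E] [NormedSpace ℝ E]

/-- The average `∫ tⁿ p (t • x) dt / t` over all scales of a function `p` on an `n`-dimensional
space. If `p` is the density of a random vector `X`, then `tⁿ p (t • x)` is the density of
`t⁻¹ • X`. -/
def scaleAverage (p : E → ℝ≥0∞) (x : E) : ℝ≥0∞ :=
  ∫⁻ t, ENNReal.ofReal (t ^ Module.finrank ℝ E) * p (t • x) ∂scaleMeasure

lemma scaleAverage_smul (p : E → ℝ≥0∞) {a : ℝ} (ha : 0 < a) (x : E) :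
    scaleAverage p (a • x) = (ENNReal.ofReal (a ^ Module.finrank ℝ E))⁻¹ * scaleAverage p x := by
  rw [scaleAverage, scaleAverage, ← lintegral_scaleMeasure_comp_mul_left _ (inv_pos.2 ha),
    ← lintegral_const_mul' _ _ (by simpa using pow_pos ha _)]
  refine lintegral_congr fun t => ?_
  rw [smul_smul, mul_right_comm, inv_mul_cancel₀ ha.ne', one_mul, mul_pow,
    ENNReal.ofReal_mul (by positivity), inv_pow, ENNReal.ofReal_inv_of_pos (by positivity),
    mul_assoc]

lemma scaleAverage_comp_smul (p : E → ℝ≥0∞) {a : ℝ} (ha : 0 < a) :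
    scaleAverage (fun x => ENNReal.ofReal (a ^ Module.finrank ℝ E) * p (a • x)) =
      scaleAverage p := by
  ext x
  rw [scaleAverage, scaleAverage, ← lintegral_scaleMeasure_comp_mul_left
    (fun t => ENNReal.ofReal (t ^ Module.finrank ℝ E) * p (t • x)) ha]
  refine lintegral_congr fun t => ?_
  rw [mul_pow, ENNReal.ofReal_mul (by positivity), smul_smul, mul_left_comm, mul_assoc]

variable [MeasurableSpace E] [BorelSpace E] [FiniteDimensional ℝ E] {p q : E → ℝ≥0∞}

lemma measurable_uncurry_scaleAverage {Θ : Type*} [MeasurableSpace Θ] {p : Θ → E → ℝ≥0∞}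
    (hp : Measurable (Function.uncurry p)) :
    Measurable fun z : Θ × E => scaleAverage (p z.1) z.2 := by
  have : Measurable fun z : (Θ × E) × ℝ => p z.1.1 (z.2 • z.1.2) :=
    hp.comp (f := fun z : (Θ × E) × ℝ => (z.1.1, z.2 • z.1.2)) (by fun_prop)
  exact Measurable.lintegral_prod_right' (f := fun z : (Θ × E) × ℝ =>
    ENNReal.ofReal (z.2 ^ Module.finrank ℝ E) * p z.1.1 (z.2 • z.1.2)) (by fun_prop)

lemma measurable_scaleAverage (hp : Measurable p) : Measurable (scaleAverage p) :=
  (measurable_uncurry_scaleAverage (p := fun _ : Unit => p) (hp.comp measurable_snd)).comp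
    (measurable_prodMk_left (x := ()))

lemma lintegral_mul_scaleAverage (μ : Measure E) [SFinite μ] {f : E → ℝ≥0∞} (hf : Measurable f)
    (hp : Measurable p) :
    ∫⁻ x, f x * scaleAverage p x ∂μ =
      ∫⁻ t, ENNReal.ofReal (t ^ Module.finrank ℝ E) * ∫⁻ x, f x * p (t • x) ∂μ ∂scaleMeasure := by
  have : Measurable fun z : E × ℝ => p (z.2 • z.1) := hp.comp (by fun_prop)
  calc ∫⁻ x, f x * scaleAverage p x ∂μ
      = ∫⁻ x, ∫⁻ t, f x * (ENNReal.ofReal (t ^ Module.finrank ℝ E) * p (t • x))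
          ∂scaleMeasure ∂μ := by
        refine lintegral_congr fun x => (lintegral_const_mul _ ?_).symm
        have : Measurable fun t : ℝ => p (t • x) := hp.comp (by fun_prop)
        fun_prop
    _ = ∫⁻ t, ∫⁻ x, f x * (ENNReal.ofReal (t ^ Module.finrank ℝ E) * p (t • x))
          ∂μ ∂scaleMeasure := lintegral_lintegral_swap (by fun_prop)
    _ = _ := by
        refine lintegral_congr fun t => ?_
        simp only [mul_left_comm (f _)]
        exact lintegral_const_mul' _ _ ENNReal.ofReal_ne_top

variable (μ : Measure E) [μ.IsAddHaarMeasure]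

lemma lintegral_comp_smul (F : E → ℝ≥0∞) {a : ℝ} (ha : 0 < a) :
    ∫⁻ x, F (a • x) ∂μ = (ENNReal.ofReal (a ^ Module.finrank ℝ E))⁻¹ * ∫⁻ x, F x ∂μ := by
  rw [← (measurableEmbedding_const_smul₀ ha.ne').lintegral_map F, Measure.map_addHaar_smul μ ha.ne',
    lintegral_smul_measure, abs_of_pos (by positivity), ENNReal.ofReal_inv_of_pos (by positivity),
    smul_eq_mul]

/-- Averaging over all scales is symmetric with respect to a weight that is homogeneous of degree
`n`, because the Haar measure of the scales is invariant under inversion. -/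
lemma lintegral_mul_scaleAverage_comm {w : E → ℝ≥0∞} (hw : Measurable w)
    (hw_smul : ∀ a : ℝ, 0 < a → ∀ x, w (a • x) = ENNReal.ofReal (a ^ Module.finrank ℝ E) * w x)
    (hp : Measurable p) (hq : Measurable q) :
    ∫⁻ x, w x * q x * scaleAverage p x ∂μ = ∫⁻ x, w x * p x * scaleAverage q x ∂μ := by
  rw [lintegral_mul_scaleAverage μ (f := fun x => w x * q x) (hw.mul hq) hp,
    lintegral_mul_scaleAverage μ (f := fun x => w x * p x) (hw.mul hp) hq,
    ← lintegral_scaleMeasure_comp_inv]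
  refine lintegral_scaleMeasure_congr fun t ht => ?_
  have ht_pow : 0 < t ^ Module.finrank ℝ E := pow_pos ht _
  have substitution := lintegral_comp_smul μ (fun x => w x * q x * p (t⁻¹ • x)) ht
  rw [inv_pow, ENNReal.ofReal_inv_of_pos ht_pow, ← substitution,
    ← lintegral_const_mul' _ _ ENNReal.ofReal_ne_top]
  refine lintegral_congr fun x => ?_
  rw [hw_smul t ht, inv_smul_smul₀ ht.ne']
  ring

lemma setLIntegral_scaleAverage_div (hp : Measurable p) (hq : Measurable q)
    (hp_zero : ∀ᵐ x ∂μ, scaleAverage p x ≠ 0) (hp_top : ∀ᵐ x ∂μ, scaleAverage p x ≠ ∞)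
    {B : Set E} (hB : MeasurableSet B) (hB_smul : ∀ a : ℝ, 0 < a → ∀ x, a • x ∈ B ↔ x ∈ B) :
    ∫⁻ x in B, scaleAverage q x / scaleAverage p x ∂μ.withDensity p = μ.withDensity q B := by
  have hAp := measurable_scaleAverage hp
  have hAq := measurable_scaleAverage hq
  have weight_smul (a : ℝ) (ha : 0 < a) (x : E) :
      B.indicator (fun x => (scaleAverage p x)⁻¹) (a • x) =
        ENNReal.ofReal (a ^ Module.finrank ℝ E) *
          B.indicator (fun x => (scaleAverage p x)⁻¹) x := by
    have ha_pow : ENNReal.ofReal (a ^ Module.finrank ℝ E) ≠ 0 := by simpa using pow_pos ha _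
    by_cases hx : x ∈ B
    · rw [Set.indicator_of_mem hx, Set.indicator_of_mem ((hB_smul a ha x).2 hx),
        scaleAverage_smul p ha, ENNReal.mul_inv (by simp) (by simp [ha_pow]), inv_inv]
    · rw [Set.indicator_of_notMem hx, Set.indicator_of_notMem (mt (hB_smul a ha x).1 hx), mul_zero]
  calc ∫⁻ x in B, scaleAverage q x / scaleAverage p x ∂μ.withDensity p
      = ∫⁻ x, B.indicator (fun x => (scaleAverage p x)⁻¹) x * p x * scaleAverage q x ∂μ := by
        rw [setLIntegral_withDensity_eq_setLIntegral_mul μ hp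
          (g := fun x => scaleAverage q x / scaleAverage p x) (hAq.div hAp) hB,
          ← lintegral_indicator hB]
        refine lintegral_congr fun x => ?_
        by_cases hx : x ∈ B
        · rw [Set.indicator_of_mem hx, Set.indicator_of_mem hx, Pi.mul_apply, div_eq_mul_inv]
          ring
        · simp [hx]
    _ = ∫⁻ x, B.indicator (fun x => (scaleAverage p x)⁻¹) x * q x * scaleAverage p x ∂μ :=
        (lintegral_mul_scaleAverage_comm μ (hAp.inv.indicator hB) weight_smul hp hq).symm
    _ = ∫⁻ x, B.indicator q x ∂μ := by
        refine lintegral_congr_ae ?_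
        filter_upwards [hp_zero, hp_top] with x hx_zero hx_top
        by_cases hx : x ∈ B
        · rw [Set.indicator_of_mem hx, Set.indicator_of_mem hx, mul_right_comm,
            ENNReal.inv_mul_cancel hx_zero hx_top, one_mul]
        · rw [Set.indicator_of_notMem hx, Set.indicator_of_notMem hx, zero_mul, zero_mul]
    _ = μ.withDensity q B := by rw [lintegral_indicator hB, withDensity_apply q hB]

end ScaleAverage

section ProductDensity

lemma measurePreserving_finCons {n : ℕ} {α : Fin (n + 1) → Type*} [∀ i, MeasurableSpace (α i)]
    (μ : ∀ i, Measure (α i)) [∀ i, SigmaFinite (μ i)] :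
    MeasurePreserving (fun z : α 0 × (∀ i : Fin n, α i.succ) => (Fin.cons z.1 z.2 : ∀ i, α i))
      ((μ 0).prod (Measure.pi fun i => μ i.succ)) (Measure.pi μ) := by
  have cons_eq (z : α 0 × (∀ i : Fin n, α i.succ)) : (Fin.cons z.1 z.2 : ∀ i, α i) =
      (MeasurableEquiv.piFinSuccAbove α 0).symm z := (Fin.insertNth_zero z.1 z.2).symm
  simp only [cons_eq]
  exact (measurePreserving_piFinSuccAbove μ 0).symm

variable {n : ℕ} {α : Fin n → Type*} [∀ i, MeasurableSpace (α i)] (μ : ∀ i, Measure (α i))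
  [∀ i, SigmaFinite (μ i)] {f : ∀ i, α i → ℝ≥0∞}

lemma lintegral_fin_prod_eq_prod (hf : ∀ i, Measurable (f i)) :
    ∫⁻ x, ∏ i, f i (x i) ∂Measure.pi μ = ∏ i, ∫⁻ y, f i y ∂μ i := by
  induction n with
  | zero => simp
  | succ n ih =>
    have tail_measurable : Measurable fun y : (∀ i : Fin n, α i.succ) => ∏ i, f i.succ (y i) :=
      Finset.measurable_prod _ fun i _ => (hf i.succ).comp (measurable_pi_apply i)
    rw [← (measurePreserving_finCons μ).lintegral_comp (by fun_prop)]
    simp only [Fin.prod_univ_succ, Fin.cons_zero, Fin.cons_succ]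
    rw [lintegral_prod_mul (hf 0).aemeasurable tail_measurable.aemeasurable,
      ih _ fun i => hf i.succ]

lemma pi_withDensity [∀ i, SigmaFinite ((μ i).withDensity (f i))] (hf : ∀ i, Measurable (f i)) :
    Measure.pi (fun i => (μ i).withDensity (f i)) =
      (Measure.pi μ).withDensity fun x => ∏ i, f i (x i) := by
  refine Measure.pi_eq fun s hs => ?_
  have indicator_prod (x : ∀ i, α i) :
      (Set.univ.pi s).indicator (fun x => ∏ i, f i (x i)) x = ∏ i, (s i).indicator (f i) (x i) := by
    by_cases hx : x ∈ Set.univ.pi s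
    · rw [Set.indicator_of_mem hx]
      exact Finset.prod_congr rfl fun i _ => (Set.indicator_of_mem (hx i trivial) _).symm
    · obtain ⟨i, hi⟩ : ∃ i, x i ∉ s i := by simpa using hx
      rw [Set.indicator_of_notMem hx,
        Finset.prod_eq_zero (Finset.mem_univ i) (Set.indicator_of_notMem hi _)]
  rw [withDensity_apply _ (MeasurableSet.univ_pi hs),
    ← lintegral_indicator (MeasurableSet.univ_pi hs), lintegral_congr indicator_prod,
    lintegral_fin_prod_eq_prod μ fun i => (hf i).indicator (hs i)]
  exact Finset.prod_congr rfl fun i _ => by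
    rw [lintegral_indicator (hs i), withDensity_apply _ (hs i)]

end ProductDensity

section GaussianLikelihood

lemma gaussianPDF_mul_left (m : ℝ) (v : ℝ≥0) {τ : ℝ} (hτ : 0 < τ) (y : ℝ) :
    gaussianPDF (τ * m) ((τ ^ 2).toNNReal * v) y =
      ENNReal.ofReal τ⁻¹ * gaussianPDF m v (τ⁻¹ * y) := by
  rw [gaussianPDF, gaussianPDF, ← ENNReal.ofReal_mul (by positivity),
    gaussianPDFReal_inv_mul hτ.ne', abs_of_pos hτ, inv_mul_cancel_left₀ hτ.ne',
    Real.toNNReal_of_nonneg (sq_nonneg τ)]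

/-- The density on `ℝⁿ` of `n` independent random variables with distribution `N(m, v)`. -/
def gaussianPiPDF {n : ℕ} (m : ℝ) (v : ℝ≥0) (x : Fin n → ℝ) : ℝ≥0∞ :=
  ∏ i, gaussianPDF m v (x i)

variable {n : ℕ}

lemma measurable_uncurry_gaussianPiPDF (v : ℝ≥0) :
    Measurable (Function.uncurry fun (m : ℝ) (x : Fin n → ℝ) => gaussianPiPDF m v x) := by
  simp only [Function.uncurry_def, gaussianPiPDF, gaussianPDF, gaussianPDFReal]
  fun_prop

lemma measurable_gaussianPiPDF (m : ℝ) (v : ℝ≥0) :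
    Measurable (gaussianPiPDF m v : (Fin n → ℝ) → ℝ≥0∞) :=
  Finset.measurable_prod _ fun i _ => (measurable_gaussianPDF m v).comp (measurable_pi_apply i)

lemma pi_gaussianReal_eq_withDensity (m : ℝ) {v : ℝ≥0} (hv : v ≠ 0) :
    Measure.pi (fun _ : Fin n => gaussianReal m v) = volume.withDensity (gaussianPiPDF m v) := by
  have h := gaussianReal_of_var_ne_zero m hv
  have : SigmaFinite (volume.withDensity (gaussianPDF m v)) := h ▸ inferInstance
  rw [h, pi_withDensity _ fun _ => measurable_gaussianPDF m v]
  rfl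

lemma gaussianPiPDF_mul_left (m : ℝ) (v : ℝ≥0) {τ : ℝ} (hτ : 0 < τ) (x : Fin n → ℝ) :
    gaussianPiPDF (τ * m) ((τ ^ 2).toNNReal * v) x =
      ENNReal.ofReal (τ⁻¹ ^ n) * gaussianPiPDF m v (τ⁻¹ • x) := by
  simp only [gaussianPiPDF, gaussianPDF_mul_left m v hτ, Finset.prod_mul_distrib,
    Finset.prod_const, Finset.card_univ, Fintype.card_fin, Pi.smul_apply, smul_eq_mul,
    ENNReal.ofReal_pow (inv_nonneg.2 hτ.le)]

lemma scaleAverage_gaussianPiPDF_mul_left (m : ℝ) (v : ℝ≥0) {τ : ℝ} (hτ : 0 < τ) :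
    scaleAverage (gaussianPiPDF (n := n) (τ * m) ((τ ^ 2).toNNReal * v)) =
      scaleAverage (gaussianPiPDF m v) := by
  rw [← scaleAverage_comp_smul (gaussianPiPDF m v) (inv_pos.2 hτ), Module.finrank_fin_fun]
  congr 1
  ext x
  exact gaussianPiPDF_mul_left m v hτ x

lemma scaleAverage_gaussianPiPDF_zero {v : ℝ≥0} (hv : v ≠ 0) :
    scaleAverage (gaussianPiPDF (n := n) 0 v) = scaleAverage (gaussianPiPDF 0 1) := by
  rw [← scaleAverage_gaussianPiPDF_mul_left 0 1 (τ := √v) (by positivity), mul_zero, mul_one,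
    Real.sq_sqrt v.coe_nonneg, Real.toNNReal_coe]

lemma scaleMixtureLikelihood_eq_scaleAverage (θ : ℝ) (x : ℕ → ℝ) :
    scaleMixtureLikelihood n θ x = scaleAverage (gaussianPiPDF θ 1) fun i : Fin n => x i := by
  rw [scaleAverage, ← lintegral_scaleMeasure_comp_inv, Module.finrank_fin_fun,
    scaleMixtureLikelihood, ← lintegral_scaleMeasure]
  refine lintegral_scaleMeasure_congr fun τ hτ => ?_
  rw [← gaussianPiPDF_mul_left θ 1 hτ, mul_one, gaussianPiPDF, Finset.prod_range]

end GaussianLikelihood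

section PartialSums

lemma partialSum_smul (n : ℕ) (a : ℝ) (x : ℕ → ℝ) :
    partialSum n (a • x) = a * partialSum n x := by
  simp [partialSum, Finset.mul_sum]

lemma partialSumSq_smul (n : ℕ) (a : ℝ) (x : ℕ → ℝ) :
    partialSumSq n (a • x) = a ^ 2 * partialSumSq n x := by
  simp [partialSumSq, Finset.mul_sum, mul_pow]

lemma partialSumSq_nonneg (n : ℕ) (x : ℕ → ℝ) : 0 ≤ partialSumSq n x :=
  Finset.sum_nonneg fun i _ => sq_nonneg (x i)

lemma partialSum_sq_le (n : ℕ) (x : ℕ → ℝ) : partialSum n x ^ 2 ≤ n * partialSumSq n x := by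
  simpa [partialSum, partialSumSq] using
    sq_sum_le_card_mul_sum_sq (s := Finset.range n) (f := x)

lemma sum_range_sub_sq (n : ℕ) (x : ℕ → ℝ) (m : ℝ) :
    ∑ i ∈ Finset.range n, (x i - m) ^ 2 =
      partialSumSq n x - 2 * m * partialSum n x + n * m ^ 2 := by
  simp only [partialSumSq, partialSum, Finset.mul_sum, sub_sq, Finset.sum_add_distrib,
    Finset.sum_sub_distrib, Finset.sum_const, Finset.card_range, nsmul_eq_mul, mul_assoc,
    mul_comm m]

end PartialSums

section ExplicitFormulas

variable {n : ℕ}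

lemma gaussianPiPDF_one_eq (θ : ℝ) (x : ℕ → ℝ) :
    gaussianPiPDF θ 1 (fun i : Fin n => x i) =
      ENNReal.ofReal ((√(2 * Real.pi) ^ n)⁻¹ *
        Real.exp (-(partialSumSq n x - 2 * θ * partialSum n x + n * θ ^ 2) / 2)) := by
  rw [gaussianPiPDF, ← Finset.prod_range fun i => gaussianPDF θ 1 (x i)]
  simp only [gaussianPDF]
  rw [← ENNReal.ofReal_prod_of_nonneg fun i _ => gaussianPDFReal_nonneg _ _ _]
  simp only [gaussianPDFReal, NNReal.coe_one, mul_one, Finset.prod_mul_distrib, Finset.prod_const,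
    Finset.card_range, inv_pow, ← Real.exp_sum, ← Finset.sum_div, Finset.sum_neg_distrib,
    sum_range_sub_sq]

/-- The constant `Cₙ` in `∫ tⁿ (2π)^(-n/2) exp (-t² A / 2) dt / t = Cₙ A^(-n/2)`, the reciprocal of
the area of the unit sphere in `ℝⁿ`. -/
def scaleConst (n : ℕ) : ℝ := Real.Gamma (n / 2) / (2 * Real.pi ^ ((n : ℝ) / 2))

lemma scaleConst_pos (hn : 0 < n) : 0 < scaleConst n := by
  have := Real.Gamma_pos_of_pos (s := (n : ℝ) / 2) (by positivity)
  unfold scaleConst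
  positivity

lemma lintegral_pow_mul_exp_scaleMeasure (hn : 0 < n) {A : ℝ} (hA : 0 < A) :
    ∫⁻ t, ENNReal.ofReal (t ^ n * ((√(2 * Real.pi) ^ n)⁻¹ * Real.exp (-(t ^ 2 * A) / 2)))
      ∂scaleMeasure = ENNReal.ofReal (scaleConst n * A ^ (-((n : ℝ) / 2))) := by
  have hn' : (-1 : ℝ) < n - 1 := by simpa using hn
  have integrand_eq (t : ℝ) (ht : 0 < t) :
      t ^ n * ((√(2 * Real.pi) ^ n)⁻¹ * Real.exp (-(t ^ 2 * A) / 2)) * t⁻¹ =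
        (√(2 * Real.pi) ^ n)⁻¹ * (t ^ ((n : ℝ) - 1) * Real.exp (-(A / 2) * t ^ (2 : ℝ))) := by
    rw [Real.rpow_sub_one ht.ne', Real.rpow_natCast, Real.rpow_two]
    ring_nf
  have integrable := (integrableOn_rpow_mul_exp_neg_mul_rpow (p := 2) hn' (by norm_num)
    (half_pos hA)).const_mul (√(2 * Real.pi) ^ n)⁻¹
  calc _ = ∫⁻ t in Set.Ioi (0 : ℝ), ENNReal.ofReal ((√(2 * Real.pi) ^ n)⁻¹ *
          (t ^ ((n : ℝ) - 1) * Real.exp (-(A / 2) * t ^ (2 : ℝ)))) := by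
        rw [lintegral_scaleMeasure]
        refine setLIntegral_congr_fun measurableSet_Ioi fun t (ht : 0 < t) => ?_
        rw [← ENNReal.ofReal_mul (by positivity), integrand_eq t ht]
    _ = ENNReal.ofReal ((√(2 * Real.pi) ^ n)⁻¹ *
          ((A / 2) ^ (-((n : ℝ) / 2)) * (1 / 2) * Real.Gamma (n / 2))) := by
        rw [← ofReal_integral_eq_lintegral_ofReal integrable, integral_const_mul,
          integral_rpow_mul_exp_neg_mul_rpow two_pos hn' (half_pos hA), sub_add_cancel, neg_div]
        filter_upwards [ae_restrict_mem measurableSet_Ioi] with t ht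
        exact mul_nonneg (by positivity)
          (mul_nonneg (Real.rpow_nonneg (le_of_lt ht) _) (Real.exp_nonneg _))
    _ = _ := by
        have sqrt_pow : √(2 * Real.pi) ^ n = 2 ^ ((n : ℝ) / 2) * Real.pi ^ ((n : ℝ) / 2) := by
          rw [← Real.mul_rpow zero_le_two Real.pi_nonneg, Real.sqrt_eq_rpow, ← Real.rpow_natCast,
            ← Real.rpow_mul (by positivity), one_div_mul_eq_div]
        rw [sqrt_pow, Real.div_rpow hA.le zero_le_two, Real.rpow_neg zero_le_two, scaleConst]
        congr 1
        field_simp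

lemma lintegral_exp_quadratic_gaussianReal_zero {κ b : ℝ} (hκ : 0 < κ) (hb : 0 < b + κ) (a : ℝ) :
    ∫⁻ θ, ENNReal.ofReal (Real.exp (a * θ - b * θ ^ 2 / 2)) ∂gaussianReal 0 (1 / κ).toNNReal =
      ENNReal.ofReal (√(κ / (b + κ)) * Real.exp (a ^ 2 / (2 * (b + κ)))) := by
  have prior_ne : (1 / κ).toNNReal ≠ 0 := by simpa using hκ
  have posterior_ne : (1 / (b + κ)).toNNReal ≠ 0 := by simpa using hb
  have normalization : (√(2 * Real.pi * (1 / κ)))⁻¹ =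
      √(κ / (b + κ)) * (√(2 * Real.pi * (1 / (b + κ))))⁻¹ := by
    rw [← Real.sqrt_inv, ← Real.sqrt_inv, ← Real.sqrt_mul (by positivity)]
    congr 1
    field_simp
  have complete_square (θ : ℝ) :
      -(θ - 0) ^ 2 / (2 * (1 / κ)) + (a * θ - b * θ ^ 2 / 2) =
        a ^ 2 / (2 * (b + κ)) + -(θ - a / (b + κ)) ^ 2 / (2 * (1 / (b + κ))) := by
    field_simp
    ring
  have density_eq (θ : ℝ) : gaussianPDF 0 (1 / κ).toNNReal θ *
        ENNReal.ofReal (Real.exp (a * θ - b * θ ^ 2 / 2)) =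
      ENNReal.ofReal (√(κ / (b + κ)) * Real.exp (a ^ 2 / (2 * (b + κ)))) *
        gaussianPDF (a / (b + κ)) (1 / (b + κ)).toNNReal θ := by
    rw [gaussianPDF, gaussianPDF, ← ENNReal.ofReal_mul (gaussianPDFReal_nonneg _ _ _),
      ← ENNReal.ofReal_mul (by positivity), gaussianPDFReal, gaussianPDFReal,
      Real.coe_toNNReal _ (by positivity), Real.coe_toNNReal _ (by positivity), mul_assoc,
      ← Real.exp_add, complete_square, Real.exp_add, normalization]
    congr 1
    ring
  rw [gaussianReal_of_var_ne_zero _ prior_ne,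
    lintegral_withDensity_eq_lintegral_mul _ (measurable_gaussianPDF _ _) (by fun_prop)]
  simp only [Pi.mul_apply, density_eq]
  rw [lintegral_const_mul _ (measurable_gaussianPDF _ _),
    lintegral_gaussianPDF_eq_one _ posterior_ne, mul_one]

lemma scaleMixtureLikelihood_eq_lintegral (θ : ℝ) (x : ℕ → ℝ) :
    scaleMixtureLikelihood n θ x =
      ∫⁻ t, ENNReal.ofReal (t ^ n * ((√(2 * Real.pi) ^ n)⁻¹ * Real.exp
        (-(t ^ 2 * partialSumSq n x - 2 * θ * (t * partialSum n x) + n * θ ^ 2) / 2)))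
        ∂scaleMeasure := by
  rw [scaleMixtureLikelihood_eq_scaleAverage, scaleAverage, Module.finrank_fin_fun]
  refine lintegral_scaleMeasure_congr fun t ht => ?_
  rw [show (t • fun i : Fin n => x i) = fun i : Fin n => (t • x) i from rfl, gaussianPiPDF_one_eq,
    partialSum_smul, partialSumSq_smul, ← ENNReal.ofReal_mul (by positivity)]

lemma scaleMixtureLikelihood_zero (hn : 0 < n) {x : ℕ → ℝ} (hV : 0 < partialSumSq n x) :
    scaleMixtureLikelihood n 0 x =
      ENNReal.ofReal (scaleConst n * partialSumSq n x ^ (-((n : ℝ) / 2))) := by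
  rw [← lintegral_pow_mul_exp_scaleMeasure hn hV, scaleMixtureLikelihood_eq_lintegral]
  simp

variable {c : ℝ} (hc : 0 < c)
include hc

lemma partialSumSq_sub_pos {x : ℕ → ℝ} (hV : 0 < partialSumSq n x) :
    0 < partialSumSq n x - partialSum n x ^ 2 / (n + c ^ 2) := by
  rw [sub_pos, div_lt_iff₀ (by positivity)]
  linarith [partialSum_sq_le n x, mul_pos hV (pow_pos hc 2)]

lemma lintegral_scaleMixtureLikelihood (hn : 0 < n) {x : ℕ → ℝ} (hV : 0 < partialSumSq n x) :
    ∫⁻ θ, scaleMixtureLikelihood n θ x ∂gaussianReal 0 (1 / c ^ 2).toNNReal =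
      ENNReal.ofReal (√(c ^ 2 / (n + c ^ 2)) * (scaleConst n *
        (partialSumSq n x - partialSum n x ^ 2 / (n + c ^ 2)) ^ (-((n : ℝ) / 2)))) := by
  have integrand_split (t θ : ℝ) :
      t ^ n * ((√(2 * Real.pi) ^ n)⁻¹ * Real.exp
          (-(t ^ 2 * partialSumSq n x - 2 * θ * (t * partialSum n x) + n * θ ^ 2) / 2)) =
        t ^ n * ((√(2 * Real.pi) ^ n)⁻¹ * Real.exp (-(t ^ 2 * partialSumSq n x) / 2)) *
          Real.exp (t * partialSum n x * θ - n * θ ^ 2 / 2) := by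
    have exponent_split :
        -(t ^ 2 * partialSumSq n x - 2 * θ * (t * partialSum n x) + n * θ ^ 2) / 2 =
          -(t ^ 2 * partialSumSq n x) / 2 + (t * partialSum n x * θ - n * θ ^ 2 / 2) := by ring
    rw [exponent_split, Real.exp_add]
    ring
  have exponent_merge (t : ℝ) :
      -(t ^ 2 * partialSumSq n x) / 2 + (t * partialSum n x) ^ 2 / (2 * (n + c ^ 2)) =
        -(t ^ 2 * (partialSumSq n x - partialSum n x ^ 2 / (n + c ^ 2))) / 2 := by
    field_simp
    ring
  simp only [scaleMixtureLikelihood_eq_lintegral]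
  rw [lintegral_lintegral_swap (by fun_prop), ENNReal.ofReal_mul (Real.sqrt_nonneg _),
    ← lintegral_pow_mul_exp_scaleMeasure hn (partialSumSq_sub_pos hc hV),
    ← lintegral_const_mul' _ _ ENNReal.ofReal_ne_top]
  refine lintegral_scaleMeasure_congr fun t ht => ?_
  have factor_nonneg : 0 ≤ t ^ n * ((√(2 * Real.pi) ^ n)⁻¹ *
    Real.exp (-(t ^ 2 * partialSumSq n x) / 2)) := by positivity
  simp only [integrand_split, ENNReal.ofReal_mul factor_nonneg]
  rw [lintegral_const_mul' _ _ ENNReal.ofReal_ne_top,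
    lintegral_exp_quadratic_gaussianReal_zero (by positivity) (by positivity),
    ← ENNReal.ofReal_mul (by positivity), ← ENNReal.ofReal_mul (by positivity), ← exponent_merge,
    Real.exp_add]
  congr 1
  ring

lemma gValue_eq_sqrt_mul_div_rpow (x : ℕ → ℝ) :
    gValue c n x = √(c ^ 2 / (n + c ^ 2)) *
      (partialSumSq n x / (partialSumSq n x - partialSum n x ^ 2 / (n + c ^ 2))) ^
        ((n : ℝ) / 2) := by
  have hn : (n : ℝ) + c ^ 2 ≠ 0 := by positivity
  rw [gValue, ← mul_div_mul_left _ (partialSumSq n x - _) hn, mul_sub, mul_div_cancel₀ _ hn]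

lemma gValue_eq_lintegral_scaleInvLR (hn : 0 < n) {x : ℕ → ℝ} (hV : 0 < partialSumSq n x) :
    ENNReal.ofReal (gValue c n x) =
      ∫⁻ θ, scaleInvLR n θ 0 x ∂gaussianReal 0 (1 / c ^ 2).toNNReal := by
  have hD := partialSumSq_sub_pos hc hV
  have hC := scaleConst_pos hn
  have null_pos : 0 < scaleConst n * partialSumSq n x ^ (-((n : ℝ) / 2)) := by positivity
  simp only [scaleInvLR, scaleMixtureLikelihood_zero hn hV, ENNReal.div_eq_inv_mul]
  rw [lintegral_const_mul' _ _ (ENNReal.inv_ne_top.2 (ENNReal.ofReal_pos.2 null_pos).ne'),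
    lintegral_scaleMixtureLikelihood hc hn hV, ← ENNReal.div_eq_inv_mul,
    ← ENNReal.ofReal_div_of_pos null_pos, gValue_eq_sqrt_mul_div_rpow hc,
    Real.div_rpow hV.le hD.le, Real.rpow_neg hV.le, Real.rpow_neg hD.le]
  congr 1
  field_simp

omit hc in
lemma gValue_nonneg (x : ℕ → ℝ) : 0 ≤ gValue c n x := by
  have hV := partialSumSq_nonneg n x
  refine mul_nonneg (Real.sqrt_nonneg _) (Real.rpow_nonneg (div_nonneg (by positivity) ?_) _)
  linarith [partialSum_sq_le n x, mul_nonneg (sq_nonneg c) hV]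

end ExplicitFormulas

section ScaleInvariance

variable {n : ℕ}

/-- The extension of a finite sequence by zeros; it turns the functions of the first `n`
observations into functions on `ℝⁿ`. -/
def extendZero (x : Fin n → ℝ) : ℕ → ℝ := Function.extend Fin.val x 0

lemma extendZero_val (x : Fin n → ℝ) (i : Fin n) : extendZero x i = x i :=
  Fin.val_injective.extend_apply _ _ _

lemma extendZero_smul (a : ℝ) (x : Fin n → ℝ) : extendZero (a • x) = a • extendZero x := by
  rw [extendZero, extendZero, ← Function.extend_smul, smul_zero]

lemma partialSum_extendZero (x : Fin n → ℝ) : partialSum n (extendZero x) = ∑ i, x i := by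
  simp [partialSum, Finset.sum_range, extendZero_val]

lemma partialSumSq_extendZero (x : Fin n → ℝ) : partialSumSq n (extendZero x) = ∑ i, x i ^ 2 := by
  simp [partialSumSq, Finset.sum_range, extendZero_val]

lemma ae_partialSumSq_extendZero_pos (hn : 0 < n) :
    ∀ᵐ x : Fin n → ℝ, 0 < partialSumSq n (extendZero x) := by
  have := Fin.pos_iff_nonempty.1 hn
  filter_upwards [Measure.ae_ne volume (0 : Fin n → ℝ)] with x hx
  obtain ⟨i, hi⟩ := Function.ne_iff.1 hx
  rw [partialSumSq_extendZero]
  exact Finset.sum_pos' (fun j _ => sq_nonneg (x j)) ⟨i, Finset.mem_univ i, sq_pos_of_ne_zero hi⟩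

lemma gValue_smul (c : ℝ) {a : ℝ} (ha : 0 < a) (x : ℕ → ℝ) :
    gValue c n (a • x) = gValue c n x := by
  have denominator : (n + c ^ 2) * (a ^ 2 * partialSumSq n x) - (a * partialSum n x) ^ 2 =
      a ^ 2 * ((n + c ^ 2) * partialSumSq n x - partialSum n x ^ 2) := by ring
  rw [gValue, gValue, partialSum_smul, partialSumSq_smul, denominator, mul_left_comm,
    mul_div_mul_left _ _ (by positivity)]

lemma gValue_extendZero (c : ℝ) (x : ℕ → ℝ) :
    gValue c n (extendZero fun i : Fin n => x i) = gValue c n x := by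
  simp only [gValue, partialSum, partialSumSq, Finset.sum_range, extendZero_val]

lemma isScaleInvariant_gValue_extendZero (c : ℝ) :
    IsScaleInvariant fun x : Fin n → ℝ => gValue c n (extendZero x) := by
  constructor
  · simp only [gValue, partialSum_extendZero, partialSumSq_extendZero]
    fun_prop
  · intro x a ha
    exact (congrArg (gValue c n) (extendZero_smul a x)).trans (gValue_smul c ha _)

variable {Ω : Type*} (X : ℕ → Ω → ℝ)

lemma measurable_scaleInvSigma {f : (Fin n → ℝ) → ℝ} (hf : IsScaleInvariant f) :
    Measurable[scaleInvSigma X n] fun ω => f fun i => X i ω :=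
  measurable_iff_comap_le.2 <| le_iSup₂_of_le (f := fun (f : (Fin n → ℝ) → ℝ)
    (_ : IsScaleInvariant f) => MeasurableSpace.comap (fun ω => f fun i => X i ω) inferInstance)
    f hf le_rfl

lemma measurable_gValue_scaleInvSigma (c : ℝ) (n : ℕ) :
    Measurable[scaleInvSigma X n] fun ω => gValue c n fun i => X i ω := by
  have h := measurable_scaleInvSigma X (isScaleInvariant_gValue_extendZero (n := n) c)
  have extendZero_eq (ω : Ω) := gValue_extendZero (n := n) c fun i => X i ω
  simpa only [extendZero_eq] using h

lemma exists_scaleInvariant_preimage {A : Set Ω} (hA : MeasurableSet[scaleInvSigma X n] A) :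
    ∃ B : Set (Fin n → ℝ), MeasurableSet B ∧ (∀ a : ℝ, 0 < a → ∀ x, a • x ∈ B ↔ x ∈ B) ∧
      (fun ω (i : Fin n) => X i ω) ⁻¹' B = A := by
  let scaleInvariantSets : MeasurableSpace (Fin n → ℝ) :=
    { MeasurableSet' := fun B => MeasurableSet B ∧ ∀ a : ℝ, 0 < a → ∀ x, a • x ∈ B ↔ x ∈ B
      measurableSet_empty := ⟨MeasurableSet.empty, fun _ _ _ => Iff.rfl⟩
      measurableSet_compl := fun B hB => ⟨hB.1.compl, fun a ha x => not_congr (hB.2 a ha x)⟩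
      measurableSet_iUnion := fun B hB => ⟨MeasurableSet.iUnion fun i => (hB i).1,
        fun a ha x => by simp only [Set.mem_iUnion, (hB _).2 a ha x]⟩ }
  have scaleInvSigma_le_comap : scaleInvSigma X n ≤
      MeasurableSpace.comap (fun ω (i : Fin n) => X i ω) scaleInvariantSets := by
    refine iSup₂_le fun f hf => ?_
    rintro _ ⟨T, hT, rfl⟩
    refine ⟨f ⁻¹' T, ⟨hf.1 hT, fun a ha x => ?_⟩, rfl⟩
    rw [Set.mem_preimage, Set.mem_preimage, show f (a • x) = f x from hf.2 x a ha]
  obtain ⟨B, ⟨hB, hB_smul⟩, hBA⟩ := scaleInvSigma_le_comap A hA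
  exact ⟨B, hB, hB_smul, hBA⟩

end ScaleInvariance

section NullMass

variable {n : ℕ} {v : ℝ≥0} (hv : v ≠ 0)
include hv

lemma scaleInvLR_extendZero (θ : ℝ) (x : Fin n → ℝ) :
    scaleInvLR n θ 0 (extendZero x) =
      scaleAverage (gaussianPiPDF θ 1) x / scaleAverage (gaussianPiPDF 0 v) x := by
  simp only [scaleInvLR, scaleMixtureLikelihood_eq_scaleAverage, extendZero_val,
    scaleAverage_gaussianPiPDF_zero hv]

variable (hn : 0 < n)
include hn

lemma ae_scaleAverage_gaussianPiPDF_zero_mem_Ioo :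
    ∀ᵐ x : Fin n → ℝ, scaleAverage (gaussianPiPDF 0 v) x ∈ Set.Ioo 0 ∞ := by
  filter_upwards [ae_partialSumSq_extendZero_pos hn] with x hx
  have hC := scaleConst_pos hn
  have explicit := scaleMixtureLikelihood_zero hn hx
  simp only [scaleMixtureLikelihood_eq_scaleAverage, extendZero_val] at explicit
  rw [scaleAverage_gaussianPiPDF_zero hv, explicit]
  exact ⟨ENNReal.ofReal_pos.2 (by positivity), ENNReal.ofReal_lt_top⟩

lemma setLIntegral_gValue_pi_gaussianReal {c : ℝ} (hc : 0 < c) {B : Set (Fin n → ℝ)}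
    (hB : MeasurableSet B) (hB_smul : ∀ a : ℝ, 0 < a → ∀ x, a • x ∈ B ↔ x ∈ B) :
    ∫⁻ x in B, ENNReal.ofReal (gValue c n (extendZero x))
        ∂Measure.pi (fun _ : Fin n => gaussianReal 0 v) =
      ∫⁻ θ, Measure.pi (fun _ : Fin n => gaussianReal θ 1) B
        ∂gaussianReal 0 (1 / c ^ 2).toNNReal := by
  have null_pos := ae_scaleAverage_gaussianPiPDF_zero_mem_Ioo hv hn
  have ratio_measurable : Measurable fun z : (Fin n → ℝ) × ℝ =>
      scaleAverage (gaussianPiPDF z.2 1) z.1 / scaleAverage (gaussianPiPDF 0 v) z.1 :=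
    ((measurable_uncurry_scaleAverage (measurable_uncurry_gaussianPiPDF 1)).comp
      measurable_swap).div ((measurable_scaleAverage (measurable_gaussianPiPDF 0 v)).comp
      measurable_fst)
  have gValue_ae_eq : ∀ᵐ x ∂(volume.withDensity (gaussianPiPDF 0 v)).restrict B,
      ENNReal.ofReal (gValue c n (extendZero x)) =
        ∫⁻ θ, scaleAverage (gaussianPiPDF θ 1) x / scaleAverage (gaussianPiPDF 0 v) x
          ∂gaussianReal 0 (1 / c ^ 2).toNNReal := by
    refine ae_restrict_of_ae ((withDensity_absolutelyContinuous _ _).ae_le ?_)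
    filter_upwards [ae_partialSumSq_extendZero_pos hn] with x hx
    simp only [gValue_eq_lintegral_scaleInvLR hc hn hx, scaleInvLR_extendZero hv]
  rw [pi_gaussianReal_eq_withDensity 0 hv, lintegral_congr_ae gValue_ae_eq,
    lintegral_lintegral_swap ratio_measurable.aemeasurable]
  refine lintegral_congr fun θ => ?_
  rw [pi_gaussianReal_eq_withDensity θ one_ne_zero]
  exact setLIntegral_scaleAverage_div volume (measurable_gaussianPiPDF 0 v)
    (measurable_gaussianPiPDF θ 1) (null_pos.mono fun x hx => hx.1.ne')
    (null_pos.mono fun x hx => hx.2.ne) hB hB_smul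

end NullMass

section IIDSample

variable {Ω : Type*} [mΩ : MeasurableSpace Ω] {X : ℕ → Ω → ℝ} {Pr : Measure Ω}

lemma IsIIDSample.map_eq_pi [IsProbabilityMeasure Pr] {P : Measure ℝ} (h : IsIIDSample X P Pr)
    (n : ℕ) : Pr.map (fun ω (i : Fin n) => X i ω) = Measure.pi fun _ => P := by
  have independent : iIndepFun (fun i : Fin n => X i) Pr := h.2.1.precomp Fin.val_injective
  rw [(iIndepFun_iff_map_fun_eq_pi_map fun i : Fin n => (h.1 i).aemeasurable).1 independent]
  simp only [h.2.2]

lemma isIIDSample_infinitePi (P : Measure ℝ) [IsProbabilityMeasure P] :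
    IsIIDSample (fun i (x : ℕ → ℝ) => x i) P (Measure.infinitePi fun _ => P) :=
  ⟨fun i => measurable_pi_apply i,
    iIndepFun_infinitePi (P := fun _ : ℕ => P) (X := fun _ y => y) fun _ => measurable_id,
    fun i => Measure.infinitePi_map_eval (μ := fun _ : ℕ => P) i⟩

lemma IsIIDSample.comp {P : Measure ℝ} (h : IsIIDSample X P Pr) {f : ℝ → ℝ} (hf : Measurable f) :
    IsIIDSample (fun i ω => f (X i ω)) (P.map f) Pr :=
  ⟨fun i => hf.comp (h.1 i), h.2.1.comp (fun _ => f) fun _ => hf,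
    fun i => by rw [← h.2.2 i, Measure.map_map hf (h.1 i), Function.comp_def]⟩

lemma IsIIDSample.sub_mean_gaussianReal {m : ℝ} {v : ℝ≥0}
    (h : IsIIDSample X (gaussianReal m v) Pr) :
    IsIIDSample (fun i ω => X i ω - m) (gaussianReal 0 v) Pr := by
  simpa only [gaussianReal_map_sub_const, sub_self] using h.comp (measurable_id'.sub_const m)

lemma measurable_gValue (hX : ∀ i, Measurable (X i)) (c : ℝ) (n : ℕ) :
    Measurable fun ω => gValue c n fun i => X i ω :=
  (measurable_gValue_scaleInvSigma X c n).mono (scaleInvSigma_le X hX n) le_rfl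

end IIDSample

section Martingale

variable {Ω : Type*} [mΩ : MeasurableSpace Ω] {X : ℕ → Ω → ℝ} {Pr : Measure Ω} {c : ℝ} {v : ℝ≥0}
  {n : ℕ}

lemma gValue_one (hc : 0 < c) {x : ℕ → ℝ} (hx : x 0 ≠ 0) : gValue c 1 x = 1 := by
  have base_eq : (1 + c ^ 2) * x 0 ^ 2 / ((1 + c ^ 2) * x 0 ^ 2 - x 0 ^ 2) =
      (c ^ 2 / (1 + c ^ 2))⁻¹ := by
    rw [show (1 + c ^ 2) * x 0 ^ 2 - x 0 ^ 2 = c ^ 2 * x 0 ^ 2 by ring]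
    field_simp
  simp only [gValue, partialSum, partialSumSq, Finset.sum_range_one, Nat.cast_one, base_eq]
  rw [← Real.sqrt_eq_rpow, Real.sqrt_inv, mul_inv_cancel₀ (by positivity)]

lemma gValue_one_ae_eq_one (hc : 0 < c) (hv : v ≠ 0) (h : IsIIDSample X (gaussianReal 0 v) Pr) :
    ∀ᵐ ω ∂Pr, gValue c 1 (fun i => X i ω) = 1 := by
  have := nullSingletonClass_gaussianReal (μ := 0) hv
  have ae_ne_zero : ∀ᵐ y ∂Pr.map (X 0), y ≠ 0 := by
    rw [h.2.2 0]
    exact Measure.ae_ne _ _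
  filter_upwards [ae_of_ae_map (h.1 0).aemeasurable ae_ne_zero] with ω hω
  exact gValue_one hc hω

variable [IsProbabilityMeasure Pr]

lemma setLIntegral_gValue (hc : 0 < c) (hn : 0 < n) (hv : v ≠ 0)
    (h : IsIIDSample X (gaussianReal 0 v) Pr) {B : Set (Fin n → ℝ)} (hB : MeasurableSet B)
    (hB_smul : ∀ a : ℝ, 0 < a → ∀ x, a • x ∈ B ↔ x ∈ B) :
    ∫⁻ ω in (fun ω (i : Fin n) => X i ω) ⁻¹' B, ENNReal.ofReal (gValue c n fun i => X i ω) ∂Pr =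
      ∫⁻ θ, Measure.infinitePi (fun _ : ℕ => gaussianReal θ 1)
        ((fun x (i : Fin n) => x i) ⁻¹' B) ∂gaussianReal 0 (1 / c ^ 2).toNNReal := by
  have sample_measurable : Measurable fun ω (i : Fin n) => X i ω :=
    measurable_pi_lambda _ fun i => h.1 i
  have gValue_measurable : Measurable fun x : Fin n → ℝ =>
      ENNReal.ofReal (gValue c n (extendZero x)) :=
    (isScaleInvariant_gValue_extendZero c).1.ennreal_ofReal
  have pushforward : ∫⁻ ω in (fun ω (i : Fin n) => X i ω) ⁻¹' B,
      ENNReal.ofReal (gValue c n fun i => X i ω) ∂Pr =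
        ∫⁻ x in B, ENNReal.ofReal (gValue c n (extendZero x))
          ∂Measure.pi fun _ => gaussianReal 0 v := by
    rw [← h.map_eq_pi n, setLIntegral_map hB gValue_measurable sample_measurable]
    exact lintegral_congr fun ω => by rw [gValue_extendZero c fun i => X i ω]
  rw [pushforward, setLIntegral_gValue_pi_gaussianReal hv hn hc hB hB_smul]
  refine lintegral_congr fun θ => ?_
  rw [← (isIIDSample_infinitePi (gaussianReal θ 1)).map_eq_pi n,
    Measure.map_apply (measurable_pi_lambda _ fun i => measurable_pi_apply _) hB]

lemma lintegral_gValue (hc : 0 < c) (hn : 0 < n) (hv : v ≠ 0)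
    (h : IsIIDSample X (gaussianReal 0 v) Pr) :
    ∫⁻ ω, ENNReal.ofReal (gValue c n fun i => X i ω) ∂Pr = 1 := by
  simpa using setLIntegral_gValue hc hn hv h MeasurableSet.univ fun _ _ _ => Iff.rfl

lemma integrable_gValue (hc : 0 < c) (hn : 0 < n) (hv : v ≠ 0)
    (h : IsIIDSample X (gaussianReal 0 v) Pr) :
    Integrable (fun ω => gValue c n fun i => X i ω) Pr := by
  refine (lintegral_ofReal_ne_top_iff_integrable (measurable_gValue h.1 c n).aestronglyMeasurable
    (ae_of_all _ fun ω => gValue_nonneg _)).1 ?_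
  rw [lintegral_gValue hc hn hv h]
  exact ENNReal.one_ne_top

lemma integral_gValue (hc : 0 < c) (hn : 0 < n) (hv : v ≠ 0)
    (h : IsIIDSample X (gaussianReal 0 v) Pr) :
    ∫ ω, gValue c n (fun i => X i ω) ∂Pr = 1 := by
  rw [integral_eq_lintegral_of_nonneg_ae (ae_of_all _ fun ω => gValue_nonneg _)
    (measurable_gValue h.1 c n).aestronglyMeasurable, lintegral_gValue hc hn hv h,
    ENNReal.toReal_one]

lemma setLIntegral_gValue_eq_of_le (hc : 0 < c) (hv : v ≠ 0)
    (h : IsIIDSample X (gaussianReal 0 v) Pr) {m : ℕ} (hm : 0 < m) (hmn : m ≤ n) {A : Set Ω}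
    (hA : MeasurableSet[scaleInvSigma X m] A) :
    ∫⁻ ω in A, ENNReal.ofReal (gValue c m fun i => X i ω) ∂Pr =
      ∫⁻ ω in A, ENNReal.ofReal (gValue c n fun i => X i ω) ∂Pr := by
  obtain ⟨B, hB, hB_smul, rfl⟩ := exists_scaleInvariant_preimage X hA
  have cylinder_measurable :
      MeasurableSet ((fun (x : Fin n → ℝ) k => x (Fin.castLE hmn k)) ⁻¹' B) :=
    (measurable_pi_lambda _ fun k => measurable_pi_apply _) hB
  exact (setLIntegral_gValue hc hm hv h hB hB_smul).trans
    (setLIntegral_gValue hc (hm.trans_le hmn) hv h cylinder_measurable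
      fun a ha x => hB_smul a ha fun k => x (Fin.castLE hmn k)).symm

lemma martingale_gValue (hc : 0 < c) (hv : v ≠ 0) (h : IsIIDSample X (gaussianReal 0 v) Pr)
    (hX : ∀ i, Measurable (X i)) :
    Martingale (fun (n : ℕ+) ω => gValue c n fun i => X i ω) (scaleInvFiltration X hX) Pr := by
  have adapted (n : ℕ+) : StronglyMeasurable[scaleInvFiltration X hX n]
      fun ω => gValue c n fun i => X i ω :=
    (measurable_gValue_scaleInvSigma X c n).stronglyMeasurable
  refine ⟨adapted, fun i j hij => (ae_eq_condExp_of_forall_setIntegral_eq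
    ((scaleInvFiltration X hX).le i) (integrable_gValue hc j.pos hv h)
    (fun A _ _ => (integrable_gValue hc i.pos hv h).integrableOn) (fun A hA _ => ?_)
    (adapted i).aestronglyMeasurable).symm⟩
  rw [integral_eq_lintegral_of_nonneg_ae (ae_of_all _ fun ω => gValue_nonneg _)
      (measurable_gValue hX c i).aestronglyMeasurable,
    integral_eq_lintegral_of_nonneg_ae (ae_of_all _ fun ω => gValue_nonneg _)
      (measurable_gValue hX c j).aestronglyMeasurable]
  exact congrArg ENNReal.toReal (setLIntegral_gValue_eq_of_le hc hv h i.pos hij hA)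

end Martingale

section Ville

variable {Ω : Type*} [mΩ : MeasurableSpace Ω] {Pr : Measure Ω}

lemma mul_measure_exists_le_of_martingale_nat [IsFiniteMeasure Pr] {ℱ : Filtration ℕ mΩ}
    {M : ℕ → Ω → ℝ} (hM : Martingale M ℱ Pr) (hM_nonneg : ∀ n ω, 0 ≤ M n ω) (ε : ℝ≥0) :
    ε * Pr {ω | ∃ n, ε ≤ M n ω} ≤ ENNReal.ofReal (∫ ω, M 0 ω ∂Pr) := by
  let crossed (N : ℕ) : Set Ω :=
    {ω | ε ≤ (Finset.range (N + 1)).sup' Finset.nonempty_range_add_one fun k => M k ω}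
  have crossed_le (N : ℕ) : ε * Pr (crossed N) ≤ ENNReal.ofReal (∫ ω, M 0 ω ∂Pr) := by
    refine (maximal_ineq hM.submartingale (fun k ω => hM_nonneg k ω) N).trans
      (ENNReal.ofReal_le_ofReal ?_)
    calc ∫ ω in crossed N, M N ω ∂Pr
        ≤ ∫ ω, M N ω ∂Pr :=
          setIntegral_le_integral (hM.integrable N) (ae_of_all _ fun ω => hM_nonneg N ω)
      _ = ∫ ω, M 0 ω ∂Pr := by
          simpa only [setIntegral_univ] using (hM.setIntegral_eq N.zero_le .univ).symm
  have crossed_mono : Monotone crossed := fun m n hmn ω hω =>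
    le_trans (α := ℝ) hω (Finset.sup'_mono _ (Finset.range_mono (by omega)) _)
  have exists_eq : {ω | ∃ n, ε ≤ M n ω} = ⋃ N, crossed N := by
    ext ω
    simp only [crossed, Set.mem_ofPred_eq, Set.mem_iUnion, Finset.le_sup'_iff, Finset.mem_range]
    exact ⟨fun ⟨n, hn⟩ => ⟨n, n, n.lt_succ_self, hn⟩, fun ⟨_, n, _, hn⟩ => ⟨n, hn⟩⟩
  rw [exists_eq, crossed_mono.measure_iUnion, ENNReal.mul_iSup]
  exact iSup_le crossed_le

lemma mul_measure_exists_le_of_martingale_pnat [IsFiniteMeasure Pr] {ℱ : Filtration ℕ+ mΩ}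
    {M : ℕ+ → Ω → ℝ} (hM : Martingale M ℱ Pr) (hM_nonneg : ∀ n ω, 0 ≤ M n ω) (ε : ℝ≥0) :
    ε * Pr {ω | ∃ n, ε ≤ M n ω} ≤ ENNReal.ofReal (∫ ω, M 1 ω ∂Pr) := by
  let 𝒢 : Filtration ℕ mΩ :=
    { seq := fun k => ℱ k.succPNat
      mono' := fun i j hij => ℱ.mono (Nat.succPNat_le_succPNat.2 hij)
      le' := fun k => ℱ.le _ }
  have shifted : Martingale (fun k => M k.succPNat) 𝒢 Pr :=
    ⟨fun k => hM.1 _, fun i j hij => hM.2 _ _ (Nat.succPNat_le_succPNat.2 hij)⟩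
  have exists_eq : {ω | ∃ n, ε ≤ M n ω} = {ω | ∃ k : ℕ, ε ≤ M k.succPNat ω} := by
    ext ω
    exact Equiv.pnatEquivNat.exists_congr_left
  rw [exists_eq]
  exact mul_measure_exists_le_of_martingale_nat shifted (fun k ω => hM_nonneg _ ω) ε

lemma ofReal_one_sub_le_measure_forall_lt_inv [IsProbabilityMeasure Pr] {ℱ : Filtration ℕ+ mΩ}
    {M : ℕ+ → Ω → ℝ} (hM : Martingale M ℱ Pr) (hM_nonneg : ∀ n ω, 0 ≤ M n ω)
    (hM_one : ∫ ω, M 1 ω ∂Pr = 1) {α : ℝ} (hα : 0 < α) :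
    ENNReal.ofReal (1 - α) ≤ Pr {ω | ∀ n, M n ω < α⁻¹} := by
  lift α to ℝ≥0 using hα.le
  have crossing_le : Pr {ω | ∃ n, (α : ℝ)⁻¹ ≤ M n ω} ≤ α := by
    have ville := mul_measure_exists_le_of_martingale_pnat hM hM_nonneg α⁻¹
    rw [hM_one, ENNReal.ofReal_one, NNReal.coe_inv,
      ENNReal.coe_inv (by exact_mod_cast hα.ne'), ← ENNReal.div_eq_inv_mul] at ville
    simpa using ENNReal.div_le_iff (by exact_mod_cast hα.ne') ENNReal.coe_ne_top |>.1 ville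
  have compl_eq : {ω | ∃ n, (α : ℝ)⁻¹ ≤ M n ω}ᶜ = {ω | ∀ n, M n ω < (α : ℝ)⁻¹} := by
    ext ω
    simp
  rw [ENNReal.ofReal_sub _ α.coe_nonneg, ENNReal.ofReal_one, ENNReal.ofReal_coe_nnreal,
    tsub_le_iff_left]
  calc 1 = Pr Set.univ := measure_univ.symm
    _ ≤ Pr {ω | ∃ n, (α : ℝ)⁻¹ ≤ M n ω} + Pr {ω | ∀ n, M n ω < (α : ℝ)⁻¹} :=
        compl_eq ▸ measure_univ_le_add_compl _
    _ ≤ α + Pr {ω | ∀ n, M n ω < (α : ℝ)⁻¹} := by gcongr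

end Ville

section ConfidenceSequence

variable {c α : ℝ} {n : ℕ}

lemma partialSum_sub_const (hn : 0 < n) (x : ℕ → ℝ) (m : ℝ) :
    partialSum n (fun i => x i - m) = n * (sampleMean n x - m) := by
  simp only [partialSum, sampleMean, Finset.sum_sub_distrib, Finset.sum_const, Finset.card_range,
    nsmul_eq_mul]
  field_simp

lemma partialSumSq_sub_const (hn : 0 < n) (x : ℕ → ℝ) (m : ℝ) :
    partialSumSq n (fun i => x i - m) =
      n * (sampleMeanSq n x - sampleMean n x ^ 2 + (sampleMean n x - m) ^ 2) := by
  rw [partialSumSq, sum_range_sub_sq, sampleMean, sampleMeanSq]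
  field_simp
  ring

lemma partialSum_sq_le_of_gValue_lt (hc : 0 < c) (hα : 0 < α) (hn : 0 < n) {x : ℕ → ℝ}
    (h : gValue c n x < α⁻¹) :
    partialSum n x ^ 2 ≤ (1 - (α ^ 2 * c ^ 2 / (n + c ^ 2)) ^ (1 / (n : ℝ))) *
      ((n + c ^ 2) * partialSumSq n x) := by
  set b := (α ^ 2 * c ^ 2 / (n + c ^ 2)) ^ (1 / (n : ℝ)) with hb
  rcases (partialSumSq_nonneg n x).eq_or_lt with hV | hV
  · simpa only [← hV, mul_zero] using partialSum_sq_le n x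
  have denominator_pos : 0 < (n + c ^ 2) * partialSumSq n x - partialSum n x ^ 2 := by
    nlinarith [mul_pos (pow_pos hc 2) hV, partialSum_sq_le n x]
  set R := (n + c ^ 2) * partialSumSq n x / ((n + c ^ 2) * partialSumSq n x - partialSum n x ^ 2)
    with hR
  have R_pos : 0 < R := by positivity
  have : 0 < b := by positivity
  have b_pow : b ^ n = α ^ 2 * c ^ 2 / (n + c ^ 2) := by
    rw [hb, one_div, Real.rpow_inv_natCast_pow (by positivity) hn.ne']
  have gValue_sq : gValue c n x ^ 2 = c ^ 2 / (n + c ^ 2) * R ^ n := by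
    rw [gValue, ← hR, mul_pow, Real.sq_sqrt (by positivity), ← Real.rpow_mul_natCast R_pos.le,
      Nat.cast_ofNat, div_mul_cancel₀ _ two_ne_zero, Real.rpow_natCast]
  have bR_pow_lt_one : (b * R) ^ n < 1 := by
    calc (b * R) ^ n = (α * gValue c n x) ^ 2 := by rw [mul_pow, b_pow, mul_pow, gValue_sq]; ring
      _ < 1 := pow_lt_one₀ (mul_nonneg hα.le (gValue_nonneg x))
          (by rwa [← lt_inv_mul_iff₀ hα, mul_one]) two_ne_zero
  have bR_lt_one : b * R < 1 := (pow_lt_one_iff_of_nonneg (by positivity) hn.ne').1 bR_pow_lt_one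
  rw [hR, ← mul_div_assoc, div_lt_one denominator_pos] at bR_lt_one
  linarith

lemma mem_interval_of_gValue_lt (hc : 0 < c) (hα : 0 < α) (hn : 0 < n) {x : ℕ → ℝ} {m : ℝ}
    (h : gValue c n (fun i => x i - m) < α⁻¹) : m ∈ interval c α n x := by
  rw [interval, radius, Set.mem_ofPred_eq]
  split_ifs with radius_infinite
  · simp
  have radiusDenom_pos : 0 < radiusDenom c α n := by
    by_contra! radiusDenom_nonpos
    exact radius_infinite (max_eq_right radiusDenom_nonpos)
  rw [max_eq_left radiusDenom_pos.le]
  have error_sq_le : (sampleMean n x - m) ^ 2 ≤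
      (n + c ^ 2) * (1 - (α ^ 2 * c ^ 2 / (n + c ^ 2)) ^ (1 / (n : ℝ))) / radiusDenom c α n *
        (sampleMeanSq n x - sampleMean n x ^ 2) := by
    have centred := partialSum_sq_le_of_gValue_lt hc hα hn h
    rw [partialSum_sub_const hn, partialSumSq_sub_const hn] at centred
    rw [div_mul_eq_mul_div, le_div_iff₀ radiusDenom_pos, radiusDenom]
    refine le_of_mul_le_mul_left ?_ (Nat.cast_pos.2 hn)
    linarith
  obtain ⟨lower, upper⟩ := abs_le.1 (Real.abs_le_sqrt error_sq_le)
  rw [← EReal.coe_sub, ← EReal.coe_add, EReal.coe_le_coe_iff, EReal.coe_le_coe_iff]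
  constructor <;> linarith

lemma isConfidenceSequence_interval {Ω : Type*} [mΩ : MeasurableSpace Ω] (X : ℕ → Ω → ℝ)
    (hc : 0 < c) (hα : 0 < α) :
    IsConfidenceSequence X normalClass mean α fun n ω => interval c α n fun i => X i ω := by
  rintro _ ⟨m, v, hv, rfl⟩ Pr hPr h
  have centred := h.sub_mean_gaussianReal
  have mean_eq : mean (gaussianReal m v) = m := integral_id_gaussianReal
  calc ENNReal.ofReal (1 - α)
      ≤ Pr {ω | ∀ n : ℕ+, gValue c n (fun i => X i ω - m) < α⁻¹} :=
        ofReal_one_sub_le_measure_forall_lt_inv (martingale_gValue hc hv centred centred.1)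
          (fun n ω => gValue_nonneg _) (integral_gValue hc one_pos hv centred) hα
    _ ≤ Pr {ω | ∀ n : ℕ+, mean (gaussianReal m v) ∈ interval c α n fun i => X i ω} :=
        measure_mono fun ω hω n => by
          rw [mean_eq]
          exact mem_interval_of_gValue_lt hc hα n.pos (hω n)

end ConfidenceSequence

end TTest

end

theorem mainTheorem2 {Ω : Type*} [mΩ : MeasurableSpace Ω] (X : ℕ → Ω → ℝ)
    (hX : ∀ i, Measurable (X i)) (c : ℝ) (hc : 0 < c) :
    -- `G` is a test martingale on the scale invariant filtration
    TTest.IsTestMartingale X (TTest.normalClassMean 0) (TTest.scaleInvFiltration X hX)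
      (fun n ω => TTest.gValue c n (fun i => X i ω)) ∧
    -- its initial value is one and all its expected values are one
    (∀ P ∈ TTest.normalClassMean 0, ∀ Pr : Measure Ω, IsProbabilityMeasure Pr →
      TTest.IsIIDSample X P Pr →
      (∀ᵐ ω ∂Pr, TTest.gValue c 1 (fun i => X i ω) = 1) ∧
      ∀ n : ℕ+, ∫ ω, TTest.gValue c n (fun i => X i ω) ∂Pr = 1) ∧
    -- it is the mixture of scale invariant likelihood ratios over a centred normal prior
    (∀ (n : ℕ+) (x : ℕ → ℝ), 0 < TTest.partialSumSq n x →
      ENNReal.ofReal (TTest.gValue c n x) =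
        ∫⁻ θ, TTest.scaleInvLR n θ 0 x ∂(gaussianReal 0 (1 / c ^ 2).toNNReal)) ∧
    -- the confidence sequence for the mean over all normal distributions
    (∀ α : ℝ, 0 < α → α < 1 →
      TTest.IsConfidenceSequence X TTest.normalClass TTest.mean α
        (fun n ω => TTest.interval c α n (fun i => X i ω))) := by
  refine ⟨?test_martingale, ?expectations,
    fun n x hV => TTest.gValue_eq_lintegral_scaleInvLR hc n.pos hV,
    fun α hα _ => TTest.isConfidenceSequence_interval X hc hα⟩
  case test_martingale =>
    rintro _ ⟨v, hv, rfl⟩ Pr hPr h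
    exact ⟨fun n ω => TTest.gValue_nonneg _, TTest.martingale_gValue hc hv h hX,
      TTest.integral_gValue hc one_pos hv h⟩
  case expectations =>
    rintro _ ⟨v, hv, rfl⟩ Pr hPr h
    exact ⟨TTest.gValue_one_ae_eq_one hc hv h, fun n => TTest.integral_gValue hc n.pos hv h⟩
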